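/- Let $p,q\ge 1$ be coprime integers and let $\varphi\in\mathbb Z$ satisfy $\varphi^p\equiv 1 \pmod q$. Let $G=\mathbb Z_q\rtimes_\varphi\mathbb Z_p$ be the group of order $pq$ generated by $a,A$ with relations $a^q=1$, $A^p=1$, $AaA^{-1}=a^\varphi$. Every element of $G$ is uniquely of the form $A^Ia^i$ with $0\le I<p$, $0\le i<q$; we write it $(a^i,A^I)$. Put $r=\gcd(\varphi^2-1,q)$, and let $\langle n\rangle_m\in\{0,\dots,m-1\}$ denote the residue of $n$ modulo $m$. Let $U(1)$ be the circle group with trivial $G$-action. Then: 1. $H^3(G,U(1))\cong\mathbb Z_p\times\mathbb Z_r$. 2. The group $G$ depends only on $\varphi$ modulo $q$, and there is an integer $\psi\equiv\varphi\pmod q$ with $\psi^p\equiv 1\pmod{r^2}$. 3. For every integer $\psi$ with $\psi\equiv\varphi\pmod q$ and $\psi^p\equiv1\pmod{r^2}$, the functions $G^3\to U(1)$ $$\omega_p\big((a^i,A^I),(a^j,A^J),(a^k,A^K)\big)=\exp\Big(\frac{2\pi\sqrt{-1}}{p^2}\,I\,[J+K-\langle J+K\rangle_p]\Big),$$ $$\omega_r\big((a^i,A^I),(a^j,A^J),(a^k,A^K)\big)=\exp\Big(\frac{2\pi\sqrt{-1}}{r^2}\,\psi^{J+K}\,i\,\big[\psi^K\langle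 j\rangle_r+\langle k\rangle_r-\langle \psi^Kj+k\rangle_r\big]\Big)$$ (where $0\le I,J,K<p$ and $0\le i,j,k<q$) are 3-cocycles, and their classes generate $H^3(G,U(1))$. -/

import Mathlib

open CategoryTheory

noncomputable section

namespace QP

theorem pow_eq_one {p q : ℕ} {φ : ℤ} (hφ : φ ^ p ≡ 1 [ZMOD q]) : (φ : ZMod q) ^ p = 1 := by
  simpa using (ZMod.intCast_eq_intCast_iff (φ ^ p) 1 q).2 hφ

/-- If `φ ^ p ≡ 1 (mod q)`, the powers of `φ` in `ZMod q` only depend on the exponent mod `p`. -/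
theorem pow_mod_eq {p q : ℕ} {φ : ℤ} (hφ : φ ^ p ≡ 1 [ZMOD q]) (n : ℕ) :
    (φ : ZMod q) ^ (n % p) = (φ : ZMod q) ^ n := by
  conv_rhs => rw [← Nat.mod_add_div n p, pow_add, pow_mul, pow_eq_one hφ, one_pow, mul_one]

theorem pow_mul_pow_eq_one {p q : ℕ} [NeZero p] {φ : ℤ} (hφ : φ ^ p ≡ 1 [ZMOD q]) (n : ℕ) :
    (φ : ZMod q) ^ ((p - 1) * n) * (φ : ZMod q) ^ n = 1 := by
  obtain ⟨m, hm⟩ := Nat.exists_eq_succ_of_ne_zero (NeZero.ne p)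
  have h := pow_eq_one hφ
  subst hm
  rw [← pow_add, show (m.succ - 1) * n + n = m.succ * n by simp [Nat.succ_mul], pow_mul, h, one_pow]

/-- The automorphism `x ↦ φ ^ n x` of the cyclic group `ℤ/q`, written multiplicatively
(so that it sends `a` to `a ^ (φ ^ n)`). -/
def powAut (p q : ℕ) [NeZero p] (φ : ℤ) (hφ : φ ^ p ≡ 1 [ZMOD q]) (n : ℕ) :
    MulAut (Multiplicative (ZMod q)) where
  toFun x := Multiplicative.ofAdd ((φ : ZMod q) ^ n * Multiplicative.toAdd x)
  invFun x := Multiplicative.ofAdd ((φ : ZMod q) ^ ((p - 1) * n) * Multiplicative.toAdd x)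
  left_inv x := by
    simp [← mul_assoc, pow_mul_pow_eq_one hφ]
  right_inv x := by
    beta_reduce
    rw [toAdd_ofAdd, ← mul_assoc, mul_comm ((φ : ZMod q) ^ n), pow_mul_pow_eq_one hφ, one_mul,
      ofAdd_toAdd]
  map_mul' x y := by
    simp [mul_add]

/-- The action of `ℤ/p` on `ℤ/q` (both written multiplicatively) in which the class of `I` acts by
`a ↦ a ^ (φ ^ I)`. -/
def action (p q : ℕ) [NeZero p] (φ : ℤ) (hφ : φ ^ p ≡ 1 [ZMOD q]) :
    Multiplicative (ZMod p) →* MulAut (Multiplicative (ZMod q)) where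
  toFun g := powAut p q φ hφ (Multiplicative.toAdd g).val
  map_one' := by
    ext x
    simp [powAut]
  map_mul' g h := by
    ext x
    simp [powAut, ZMod.val_add, pow_mod_eq hφ, pow_add, mul_assoc]

/-- The group `ℤ_q ⋊_φ ℤ_p`, for an integer `φ` with `φ ^ p ≡ 1 (mod q)`. -/
abbrev Grp (p q : ℕ) [NeZero p] (φ : ℤ) (hφ : φ ^ p ≡ 1 [ZMOD q]) : Type :=
  Multiplicative (ZMod q) ⋊[action p q φ hφ] Multiplicative (ZMod p)

section Generators

variable (p q : ℕ) [NeZero p] (φ : ℤ) (hφ : φ ^ p ≡ 1 [ZMOD q])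

/-- The generator `a` of the normal subgroup `ℤ_q`. -/
def genSmallA : Grp p q φ hφ := SemidirectProduct.inl (Multiplicative.ofAdd 1)

/-- The generator `A` of the complement `ℤ_p`. -/
def genBigA : Grp p q φ hφ := SemidirectProduct.inr (Multiplicative.ofAdd 1)

end Generators

variable {p q : ℕ} [NeZero p] {φ : ℤ} {hφ : φ ^ p ≡ 1 [ZMOD q]}

/-- Every element is uniquely `A ^ I * a ^ i` with `0 ≤ I < p` and `0 ≤ i < q`; this is `I`. -/
def bigExp (g : Grp p q φ hφ) : ℕ := (Multiplicative.toAdd g.right).val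

/-- Every element is uniquely `A ^ I * a ^ i` with `0 ≤ I < p` and `0 ≤ i < q`; this is `i`. -/
def smallExp (g : Grp p q φ hφ) : ℕ :=
  (Multiplicative.toAdd ((SemidirectProduct.inr g.right)⁻¹ * g).left).val

/-! The defining relations of the group, and the meaning of the two exponents. -/

theorem genSmallA_pow : genSmallA p q φ hφ ^ q = 1 := by
  rw [genSmallA, ← map_pow, ← ofAdd_nsmul]
  simp

theorem genBigA_pow : genBigA p q φ hφ ^ p = 1 := by
  rw [genBigA, ← map_pow, ← ofAdd_nsmul]
  simp

theorem genBigA_conj :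
    genBigA p q φ hφ * genSmallA p q φ hφ * (genBigA p q φ hφ)⁻¹ = genSmallA p q φ hφ ^ φ := by
  rw [genBigA, genSmallA, ← map_inv, ← SemidirectProduct.inl_aut, ← map_zpow, ← ofAdd_zsmul]
  congr 1
  simp only [action, powAut, MonoidHom.coe_mk, OneHom.coe_mk, MulEquiv.coe_mk, Equiv.coe_fn_mk,
    toAdd_ofAdd, mul_one, zsmul_eq_mul]
  congr 1
  have h : (1 : ZMod p).val = 1 % p := ZMod.val_one_eq_one_mod p
  rw [h, pow_mod_eq hφ, pow_one]

theorem eq_pow_mul_pow [NeZero q] (g : Grp p q φ hφ) :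
    g = genBigA p q φ hφ ^ bigExp g * genSmallA p q φ hφ ^ smallExp g := by
  have h1 : genBigA p q φ hφ ^ bigExp g = SemidirectProduct.inr g.right := by
    rw [genBigA, ← map_pow, ← ofAdd_nsmul]
    simp [bigExp]
  have h2 : genSmallA p q φ hφ ^ smallExp g = (SemidirectProduct.inr g.right)⁻¹ * g := by
    rw [genSmallA, ← map_pow, ← ofAdd_nsmul]
    ext <;> simp [smallExp]
  rw [h1, h2, mul_inv_cancel_left]

theorem bigExp_lt (g : Grp p q φ hφ) : bigExp g < p := ZMod.val_lt _

theorem smallExp_lt [NeZero q] (g : Grp p q φ hφ) : smallExp g < q := ZMod.val_lt _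

theorem card_grp : Nat.card (Grp p q φ hφ) = q * p := by
  rw [SemidirectProduct.card]
  congr 1 <;> exact Nat.card_zmod _

section Cohomology

variable (p q φ hφ)

/-- `U(1)` as a trivial module (written additively) over `ℤ_q ⋊_φ ℤ_p`. -/
abbrev U1 : Rep ℤ (Grp p q φ hφ) := Rep.trivial ℤ (Grp p q φ hφ) (Additive Circle)

/-- `H³(ℤ_q ⋊_φ ℤ_p, U(1))`. -/
abbrev H3 : ModuleCat ℤ := groupCohomology (U1 p q φ hφ) 3

/-- A `U(1)`-valued 3-cochain is a 3-cocycle if its inhomogeneous coboundary vanishes. -/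
def IsCocycle (ω : (Fin 3 → Grp p q φ hφ) → Additive Circle) : Prop :=
  inhomogeneousCochains.d (U1 p q φ hφ) 3 ω = 0

/-- The class in `H³(ℤ_q ⋊_φ ℤ_p, U(1))` of a 3-cocycle. -/
def cls (ω : (Fin 3 → Grp p q φ hφ) → Additive Circle) (h : IsCocycle p q φ hφ ω) :
    H3 p q φ hφ :=
  groupCohomology.π (U1 p q φ hφ) 3 (groupCohomology.cocyclesMk (A := U1 p q φ hφ) ω h)

/-- `ω_p (A^I a^i, A^J a^j, A^K a^k) = exp (2πi / p² · I (J + K - ⟨J + K⟩_p))`. -/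
def omegaP (x : Fin 3 → Grp p q φ hφ) : Additive Circle :=
  let I : ℤ := bigExp (x 0)
  let J : ℤ := bigExp (x 1)
  let K : ℤ := bigExp (x 2)
  Additive.ofMul (Circle.exp
    (2 * Real.pi / (p : ℝ) ^ 2 * ((I * (J + K - (J + K) % (p : ℤ)) : ℤ) : ℝ)))

/-- `ω_r (A^I a^i, A^J a^j, A^K a^k) =
exp (2πi / r² · ψ^(J+K) i (ψ^K ⟨j⟩_r + ⟨k⟩_r - ⟨ψ^K j + k⟩_r))`,
with the exponents taken in `0 ≤ I, J, K < p` and `0 ≤ i, j, k < q`. Here `ψ` is an integer in the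
residue class of `φ` modulo `q`, so that `ℤ_q ⋊_φ ℤ_p` and `ℤ_q ⋊_ψ ℤ_p` are the same group. -/
def omegaR (r : ℕ) (ψ : ℤ) (x : Fin 3 → Grp p q φ hφ) : Additive Circle :=
  let i : ℤ := smallExp (x 0)
  let j : ℤ := smallExp (x 1)
  let k : ℤ := smallExp (x 2)
  let J : ℕ := bigExp (x 1)
  let K : ℕ := bigExp (x 2)
  Additive.ofMul (Circle.exp
    (2 * Real.pi / (r : ℝ) ^ 2 *
      ((ψ ^ (J + K) * i *
        (ψ ^ K * (j % (r : ℤ)) + k % (r : ℤ) - (ψ ^ K * j + k) % (r : ℤ)) : ℤ) : ℝ)))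

end Cohomology

end QP

end

/-! A class in H³(G, U(1)) is determined by two numbers, its slant products with the cyclic groups
generated by `A` and `a`. On a cyclic group of order n, H³ is generated by one standard cocycle
whose slant product with the j-th power of the generator is exp(2πi j²/n). Hence slant products are
quadratic in the generator, and a vanishing slant product makes a cocycle on a cyclic group a
coboundary.

The slant at `A` is killed by p. The slant at `a` is killed by q, and also by φ² - 1, because
conjugation by `A` sends `a` to `a ^ φ` and acts trivially on cohomology; so it is killed by r
(`IsCocycle₃.zsmul_slant_genSmallA`). If both slants vanish, the restrictions to both subgroups are
coboundaries, transfer shows that q and p kill the class, and coprimality shows that the class is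
zero (`IsCocycle₃.isCoboundary₃_of_slant`).

Both explicit cochains are instances of one twisted cup product (`cup_isCocycle₃`). Writing the
slants as fractions of a full turn, `omegaP` has (1/p, 0) and `omegaR` has (0, t/r), where q = r t.
Since t is prime to r (`exists_eq_gcd_mul`), these two classes are independent of orders p and r and
reach every admissible pair of slants. -/

noncomputable section

namespace QP

/-! ### Inhomogeneous cochains: conjugation, transfer and slant products. -/

section Cochains

variable {G C M : Type} [Group G] [Group C] [AddCommGroup M]

/-- The condition that an inhomogeneous 3-cochain with trivial coefficients is a cocycle. -/
def IsCocycle₃ (f : G → G → G → M) : Prop :=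
  ∀ a b c d, f b c d - f (a * b) c d + f a (b * c) d - f a b (c * d) + f a b c = 0

/-- The condition that an inhomogeneous 3-cochain with trivial coefficients is a coboundary. -/
def IsCoboundary₃ (f : G → G → G → M) : Prop :=
  ∃ β : G → G → M, ∀ a b c, f a b c = β b c - β (a * b) c + β a (b * c) - β a b

theorem IsCocycle₃.comp {f : G → G → G → M} (hf : IsCocycle₃ f) (ι : C →* G) :
    IsCocycle₃ fun a b c => f (ι a) (ι b) (ι c) := fun a b c d => by
  simpa using hf (ι a) (ι b) (ι c) (ι d)

theorem IsCocycle₃.add {f g : G → G → G → M} (hf : IsCocycle₃ f) (hg : IsCocycle₃ g) :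
    IsCocycle₃ (f + g) := fun a b c d => by
  have h1 := hf a b c d
  have h2 := hg a b c d
  simp only [Pi.add_apply]
  linear_combination (norm := abel) h1 + h2

theorem IsCocycle₃.zsmul {f : G → G → G → M} (hf : IsCocycle₃ f) (n : ℤ) :
    IsCocycle₃ (n • f) := fun a b c d => by
  have h1 := hf a b c d
  simp only [Pi.smul_apply]
  rw [← smul_zero n, ← h1]
  simp only [smul_add, smul_sub]

theorem IsCoboundary₃.add {f g : G → G → G → M} (hf : IsCoboundary₃ f) (hg : IsCoboundary₃ g) :
    IsCoboundary₃ (f + g) := by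
  obtain ⟨β, hβ⟩ := hf
  obtain ⟨γ, hγ⟩ := hg
  refine ⟨β + γ, fun a b c => ?_⟩
  simp only [Pi.add_apply, hβ, hγ]
  abel

theorem IsCoboundary₃.zsmul {f : G → G → G → M} (hf : IsCoboundary₃ f) (n : ℤ) :
    IsCoboundary₃ (n • f) := by
  obtain ⟨β, hβ⟩ := hf
  refine ⟨n • β, fun a b c => ?_⟩
  simp only [Pi.smul_apply, hβ, smul_add, smul_sub]

/-- Conjugation acts trivially on cohomology. -/
theorem IsCocycle₃.conj_sub {f : G → G → G → M} (hf : IsCocycle₃ f) (x : G) :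
    IsCoboundary₃ fun a b c =>
      f (x * a * x⁻¹) (x * b * x⁻¹) (x * c * x⁻¹) - f a b c := by
  -- The prism operator: `x` is inserted in each of the three positions, and the arguments to its
  -- left are conjugated.
  refine ⟨fun a b => -(f x a b - f (x * a * x⁻¹) x b + f (x * a * x⁻¹) (x * b * x⁻¹) x),
    fun a b c => ?_⟩
  have h1 := hf x a b c
  have h2 := hf (x * a * x⁻¹) x b c
  have h3 := hf (x * a * x⁻¹) (x * b * x⁻¹) x c
  have h4 := hf (x * a * x⁻¹) (x * b * x⁻¹) (x * c * x⁻¹) x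
  simp only [mul_assoc, inv_mul_cancel_left, inv_mul_cancel, mul_one] at h1 h2 h3 h4 ⊢
  linear_combination (norm := abel) h4 - h3 + h2 - h1

/-- If the restriction of a cocycle along `ι` is a coboundary, then so is its multiple by the index
of `ι`. Here `ρ` is a `C`-equivariant retraction and `τ` a system of right coset representatives. -/
theorem IsCocycle₃.transfer {f : G → G → G → M} (hf : IsCocycle₃ f) (ι : C →* G) (ρ : G → C)
    (hρ : ∀ c x, ρ (ι c * x) = c * ρ x) {T : Type} [Fintype T] (τ : T → G)
    (hτ : ∀ g, ∃ e : Equiv.Perm T, ∀ t, ∃ c, τ t * g = ι c * τ (e t))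
    (h : IsCoboundary₃ fun a b c => f (ι a) (ι b) (ι c)) :
    IsCoboundary₃ ((Fintype.card T : ℤ) • f) := by
  obtain ⟨β, hβ⟩ := h
  -- The homogeneous form of `f`, invariant under left translation.
  let F : G → G → G → G → M := fun x y z w => f (x⁻¹ * y) (y⁻¹ * z) (z⁻¹ * w)
  have hF : ∀ x y z w v, F y z w v - F x z w v + F x y w v - F x y z v + F x y z w = 0 := by
    intro x y z w v
    simpa [F, mul_assoc] using hf (x⁻¹ * y) (y⁻¹ * z) (z⁻¹ * w) (w⁻¹ * v)
  have hFG : ∀ g x y z w, F (g * x) (g * y) (g * z) (g * w) = F x y z w := by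
    intro g x y z w
    simp [F, mul_assoc]
  let r : G → G := fun x => ι (ρ x)
  have hr : ∀ c x, r (ι c * x) = ι c * r x := fun c x => by simp [r, hρ]
  let b : G → G → G → M := fun x y z => β ((ρ x)⁻¹ * ρ y) ((ρ y)⁻¹ * ρ z)
  have hb : ∀ x y z w, F (r x) (r y) (r z) (r w) = b y z w - b x z w + b x y w - b x y z := by
    intro x y z w
    have := hβ ((ρ x)⁻¹ * ρ y) ((ρ y)⁻¹ * ρ z) ((ρ z)⁻¹ * ρ w)
    simpa [F, b, r, mul_assoc] using this
  -- The first three terms are the prism homotopy from the identity to the retraction `r`; `b` is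
  -- the given primitive pulled back along `ρ`. Together they form a primitive of `F` that is only
  -- `C`-invariant.
  let B : G → G → G → M := fun x y z =>
    F (r x) x y z - F (r x) (r y) y z + F (r x) (r y) (r z) z + b x y z
  have hB : ∀ x y z w, F x y z w = B y z w - B x z w + B x y w - B x y z := by
    intro x y z w
    have h0 := hb x y z w
    have h1 := hF (r x) x y z w
    have h2 := hF (r x) (r y) y z w
    have h3 := hF (r x) (r y) (r z) z w
    have h4 := hF (r x) (r y) (r z) (r w) w
    simp only [B]
    linear_combination (norm := abel) h1 - h2 + h3 - h4 + h0
  have hBC : ∀ c x y z, B (ι c * x) (ι c * y) (ι c * z) = B x y z := by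
    intro c x y z
    have : b (ι c * x) (ι c * y) (ι c * z) = b x y z := by simp [b, hρ, mul_assoc]
    simp only [B, hr, hFG, this]
  -- Summing over coset representatives gives full `G`-invariance, since right multiplication
  -- permutes the cosets. The price is the factor `card T`.
  let S : G → G → G → M := fun x y z => ∑ t, B (τ t * x) (τ t * y) (τ t * z)
  have hS : ∀ g x y z, S (g * x) (g * y) (g * z) = S x y z := by
    intro g x y z
    obtain ⟨e, he⟩ := hτ g
    simp only [S]
    rw [← Equiv.sum_comp e fun t => B (τ t * x) (τ t * y) (τ t * z)]
    refine Finset.sum_congr rfl fun t _ => ?_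
    obtain ⟨c, hc⟩ := he t
    simp only [← mul_assoc, hc]
    simp only [mul_assoc, hBC]
  refine ⟨fun a b => S 1 a (a * b), fun a b c => ?_⟩
  have h1 : S 1 b (b * c) = S a (a * b) (a * (b * c)) := by
    rw [← hS a, mul_one]
  have h2 : (Fintype.card T : ℤ) • f a b c =
      ∑ t, F (τ t * 1) (τ t * a) (τ t * (a * b)) (τ t * (a * (b * c))) := by
    simp only [hFG]
    simp [F, mul_assoc]
  simp only [Pi.smul_apply, h1, h2, hB, S, Finset.sum_sub_distrib, Finset.sum_add_distrib,
    mul_assoc]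

/-- The slant product of a 3-cochain with the fundamental cycle of the cyclic group generated by an
element `s` with `s ^ n = 1`. -/
def slant (s : G) (n : ℕ) (f : G → G → G → M) : M := ∑ m ∈ Finset.range n, f s (s ^ m) s

theorem slant_add (s : G) (n : ℕ) (f g : G → G → G → M) :
    slant s n (f + g) = slant s n f + slant s n g := by
  simp [slant, Finset.sum_add_distrib]

theorem slant_zsmul (s : G) (n : ℕ) (k : ℤ) (f : G → G → G → M) :
    slant s n (k • f) = k • slant s n f := by
  simp [slant, Finset.smul_sum]

/-- The sum telescopes in β(s, s^m) - β(s^m, s), and its two ends agree because `s ^ n = 1`. So the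
slant product depends only on the class. -/
theorem IsCoboundary₃.slant_eq_zero {f : G → G → G → M} (hf : IsCoboundary₃ f) {s : G} {n : ℕ}
    (hs : s ^ n = 1) : slant s n f = 0 := by
  obtain ⟨β, hβ⟩ := hf
  have h : ∀ m ∈ Finset.range n, f s (s ^ m) s =
      (β s (s ^ (m + 1)) - β (s ^ (m + 1)) s) - (β s (s ^ m) - β (s ^ m) s) := by
    intro m _
    rw [hβ, ← pow_succ, ← pow_succ']
    abel
  rw [slant, Finset.sum_congr rfl h, Finset.sum_range_sub fun m => β s (s ^ m) - β (s ^ m) s]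
  simp [hs]

end Cochains

/-! ### Comparison of group cohomology in degree 3 with explicit cochains. -/

section Bridge

variable {G M : Type} [Group G] [AddCommGroup M]

theorem d_three_apply (ω : (Fin 3 → G) → M) (x : Fin 4 → G) :
    inhomogeneousCochains.d (Rep.trivial ℤ G M) 3 ω x =
      ω ![x 1, x 2, x 3] - ω ![x 0 * x 1, x 2, x 3] + ω ![x 0, x 1 * x 2, x 3]
        - ω ![x 0, x 1, x 2 * x 3] + ω ![x 0, x 1, x 2] := by
  have h : ∀ j : Fin 4, ∀ y : Fin 3 → G, (y 0 = Fin.contractNth j (· * ·) x 0 ∧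
      y 1 = Fin.contractNth j (· * ·) x 1 ∧ y 2 = Fin.contractNth j (· * ·) x 2) →
      Fin.contractNth j (· * ·) x = y := by
    rintro j y ⟨h0, h1, h2⟩
    funext i
    fin_cases i
    · exact h0.symm
    · exact h1.symm
    · exact h2.symm
  rw [inhomogeneousCochains.d_hom_apply]
  rw [Fin.sum_univ_four, h 0 ![x 0 * x 1, x 2, x 3] ⟨rfl, rfl, rfl⟩,
    h 1 ![x 0, x 1 * x 2, x 3] ⟨rfl, rfl, rfl⟩, h 2 ![x 0, x 1, x 2 * x 3] ⟨rfl, rfl, rfl⟩,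
    h 3 ![x 0, x 1, x 2] ⟨rfl, rfl, rfl⟩]
  have h' : (fun i : Fin 3 => x i.succ) = ![x 1, x 2, x 3] := by
    funext i
    fin_cases i <;> rfl
  rw [h']
  simp [pow_succ]
  abel

theorem d_two_apply (β : (Fin 2 → G) → M) (x : Fin 3 → G) :
    inhomogeneousCochains.d (Rep.trivial ℤ G M) 2 β x =
      β ![x 1, x 2] - β ![x 0 * x 1, x 2] + β ![x 0, x 1 * x 2] - β ![x 0, x 1] := by
  have h : ∀ j : Fin 3, ∀ y : Fin 2 → G, (y 0 = Fin.contractNth j (· * ·) x 0 ∧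
      y 1 = Fin.contractNth j (· * ·) x 1) → Fin.contractNth j (· * ·) x = y := by
    rintro j y ⟨h0, h1⟩
    funext i
    fin_cases i
    · exact h0.symm
    · exact h1.symm
  rw [inhomogeneousCochains.d_hom_apply]
  rw [Fin.sum_univ_three, h 0 ![x 0 * x 1, x 2] ⟨rfl, rfl⟩,
    h 1 ![x 0, x 1 * x 2] ⟨rfl, rfl⟩, h 2 ![x 0, x 1] ⟨rfl, rfl⟩]
  have h' : (fun i : Fin 2 => x i.succ) = ![x 1, x 2] := by
    funext i
    fin_cases i <;> rfl
  rw [h']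
  simp [pow_succ]
  abel

/-- An uncurried 3-cochain, curried. -/
def curry₃ (ω : (Fin 3 → G) → M) (a b c : G) : M := ω ![a, b, c]

theorem d_three_eq_zero_iff (ω : (Fin 3 → G) → M) :
    inhomogeneousCochains.d (Rep.trivial ℤ G M) 3 ω = 0 ↔ IsCocycle₃ (curry₃ ω) := by
  constructor
  · intro h a b c d
    rw [← show _ = (0 : M) from congrFun h ![a, b, c, d]]
    exact (d_three_apply ω ![a, b, c, d]).symm
  · intro h
    funext x
    exact (d_three_apply ω x).trans (h (x 0) (x 1) (x 2) (x 3))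

theorem exists_d_two_iff (ω : (Fin 3 → G) → M) :
    (∃ β, inhomogeneousCochains.d (Rep.trivial ℤ G M) 2 β = ω) ↔ IsCoboundary₃ (curry₃ ω) := by
  constructor
  · rintro ⟨β, rfl⟩
    exact ⟨fun a b => β ![a, b], fun a b c => d_two_apply β ![a, b, c]⟩
  · rintro ⟨β, hβ⟩
    refine ⟨fun x => β (x 0) (x 1), funext fun x => ?_⟩
    refine (d_two_apply _ x).trans ((hβ (x 0) (x 1) (x 2)).symm.trans ?_)
    refine congrArg ω (funext fun i => ?_)
    fin_cases i <;> rfl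

open groupCohomology

theorem iCocycles_injective (A : Rep ℤ G) (n : ℕ) : Function.Injective (iCocycles A n) :=
  (ModuleCat.mono_iff_injective _).1 inferInstance

/-- Cohomology is the cokernel of the differential into cocycles, so the kernel of the projection is
the image of that differential. -/
theorem π_three_eq_zero_iff (A : Rep ℤ G) (z : cocycles A 3) :
    π A 3 z = 0 ↔ ∃ β, inhomogeneousCochains.d A 2 β = iCocycles A 3 z := by
  have hex := ShortComplex.exact_of_g_is_cokernel
    (ShortComplex.mk (toCocycles A 2 3) (π A 3)
      ((inhomogeneousCochains A).toCycles_comp_homologyπ 2 3))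
    ((inhomogeneousCochains A).homologyIsCokernel 2 3 (by simp))
  have hi : ∀ β, iCocycles A 3 (toCocycles A 2 3 β) = inhomogeneousCochains.d A 2 β := by
    intro β
    rw [← inhomogeneousCochains.d_def, ← (inhomogeneousCochains A).toCycles_i 2 3]
    rfl
  constructor
  · intro h
    obtain ⟨β, hβ⟩ := (ShortComplex.moduleCat_exact_iff _).1 hex z h
    exact ⟨β, by rw [← hi, ← hβ]⟩
  · rintro ⟨β, hβ⟩
    rw [← iCocycles_injective A 3 ((hi β).trans hβ)]
    exact ConcreteCategory.congr_hom ((inhomogeneousCochains A).toCycles_comp_homologyπ 2 3) β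

/-- The cohomology class of a 3-cocycle with trivial coefficients. -/
def class₃ (f : G → G → G → M) (hf : IsCocycle₃ f) : groupCohomology (Rep.trivial ℤ G M) 3 :=
  π (Rep.trivial ℤ G M) 3 (cocyclesMk (A := Rep.trivial ℤ G M)
    (fun x => f (x 0) (x 1) (x 2)) ((d_three_eq_zero_iff _).2 hf))

theorem π_cocyclesMk_eq_class₃ (ω : (Fin 3 → G) → M)
    (h : inhomogeneousCochains.d (Rep.trivial ℤ G M) 3 ω = 0) :
    π (Rep.trivial ℤ G M) 3 (cocyclesMk (A := Rep.trivial ℤ G M) ω h) =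
      class₃ (curry₃ ω) ((d_three_eq_zero_iff ω).1 h) := by
  have : (fun x : Fin 3 → G => curry₃ ω (x 0) (x 1) (x 2)) = ω := funext fun x =>
    congrArg ω (funext fun i => by fin_cases i <;> rfl)
  unfold class₃
  congr 2
  exact this.symm

theorem exists_class₃ (x : groupCohomology (Rep.trivial ℤ G M) 3) :
    ∃ (f : G → G → G → M) (hf : IsCocycle₃ f), class₃ f hf = x := by
  induction x using groupCohomology_induction_on with
  | h z =>
    have hz : inhomogeneousCochains.d (Rep.trivial ℤ G M) 3
        (iCocycles (Rep.trivial ℤ G M) 3 z) = 0 := by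
      rw [← inhomogeneousCochains.d_def]
      exact ConcreteCategory.congr_hom
        ((inhomogeneousCochains (Rep.trivial ℤ G M)).iCycles_d 3 4) z
    refine ⟨_, (d_three_eq_zero_iff _).1 hz, ?_⟩
    rw [← π_cocyclesMk_eq_class₃ _ hz]
    exact congrArg _ (iCocycles_injective _ _ (iCocycles_mk _ hz))

theorem class₃_eq_zero_iff (f : G → G → G → M) (hf : IsCocycle₃ f) :
    class₃ f hf = 0 ↔ IsCoboundary₃ f := by
  rw [class₃, π_three_eq_zero_iff, iCocycles_mk]
  exact exists_d_two_iff _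

theorem class₃_add (f g : G → G → G → M) (hf : IsCocycle₃ f) (hg : IsCocycle₃ g) :
    class₃ (f + g) (hf.add hg) = class₃ f hf + class₃ g hg := by
  unfold class₃
  rw [← map_add]
  refine congrArg _ (iCocycles_injective _ _ ?_)
  rw [map_add, iCocycles_mk, iCocycles_mk, iCocycles_mk]
  rfl

theorem class₃_zsmul (n : ℤ) (f : G → G → G → M) (hf : IsCocycle₃ f) :
    class₃ (n • f) (hf.zsmul n) = n • class₃ f hf := by
  unfold class₃
  rw [← map_zsmul]
  refine congrArg _ (iCocycles_injective _ _ ?_)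
  rw [map_zsmul, iCocycles_mk, iCocycles_mk]
  rfl

theorem class₃_eq_iff (f g : G → G → G → M) (hf : IsCocycle₃ f) (hg : IsCocycle₃ g) :
    class₃ f hf = class₃ g hg ↔ IsCoboundary₃ (f + (-1 : ℤ) • g) := by
  rw [← class₃_eq_zero_iff _ (hf.add (hg.zsmul (-1))), class₃_add, class₃_zsmul, neg_one_zsmul,
    ← sub_eq_add_neg, sub_eq_zero]
  exact hg.zsmul (-1)

end Bridge

/-! ### Roots of unity in the circle. -/

/-- The character `z ↦ exp (2πi z / N)` of `ℤ`. -/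
def circ (N : ℕ) : ℤ →+ Additive Circle where
  toFun z := Additive.ofMul (Circle.exp (2 * Real.pi / N * z))
  map_zero' := by simp
  map_add' x y := by
    rw [← ofMul_mul, ← Circle.exp_add, ← mul_add, Int.cast_add]

theorem circ_eq_zero_iff {N : ℕ} (hN : N ≠ 0) (z : ℤ) : circ N z = 0 ↔ (N : ℤ) ∣ z := by
  have hN' : (N : ℝ) ≠ 0 := Nat.cast_ne_zero.2 hN
  change Additive.ofMul (Circle.exp (2 * Real.pi / N * z)) = Additive.ofMul 1 ↔ _
  rw [Additive.ofMul.injective.eq_iff, Circle.exp_eq_one]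
  refine exists_congr fun k => ?_
  rw [show 2 * Real.pi / N * z = (z : ℝ) / N * (2 * Real.pi) by ring,
    mul_left_inj' Real.two_pi_pos.ne', div_eq_iff hN', ← @Int.cast_inj ℝ]
  push_cast
  rw [mul_comm]

theorem circ_eq_iff {N : ℕ} (hN : N ≠ 0) (x y : ℤ) : circ N x = circ N y ↔ (N : ℤ) ∣ x - y := by
  rw [← circ_eq_zero_iff hN, map_sub, sub_eq_zero]

theorem circ_mul_mul {N k : ℕ} (hk : k ≠ 0) (z : ℤ) : circ (N * k) (k * z) = circ N z := by
  have hk' : (k : ℝ) ≠ 0 := Nat.cast_ne_zero.2 hk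
  refine congrArg (fun t => Additive.ofMul (Circle.exp t)) ?_
  push_cast
  field_simp

theorem exists_circ_of_zsmul_eq_zero {N : ℕ} (hN : N ≠ 0) (u : Additive Circle)
    (hu : (N : ℤ) • u = 0) : ∃ k : ℤ, u = circ N k := by
  have hN' : (N : ℝ) ≠ 0 := Nat.cast_ne_zero.2 hN
  obtain ⟨t, ht⟩ := Circle.exp_surjective u.toMul
  have h : Circle.exp (N * t) = 1 := by
    rw [← nsmul_eq_mul, Circle.exp_nsmul, ht]
    simpa using congrArg Additive.toMul hu
  obtain ⟨k, hk⟩ := Circle.exp_eq_one.1 h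
  refine ⟨k, ?_⟩
  change Additive.ofMul u.toMul = Additive.ofMul (Circle.exp (2 * Real.pi / N * k))
  rw [← ht]
  congr 2
  field_simp
  linarith

/-! ### The twisted cup product of a 1-cocycle with a Bockstein. -/

section Cup

variable {G : Type} [Group G]

/-- The cup product of the (twisted) 1-cocycle `i` with the Bockstein of the reduction of `x`, all
functions being twisted by the quadratic character `χ`. -/
def cup (N : ℕ) (χ i x : G → ℤ) (a b c : G) : Additive Circle :=
  circ (N ^ 2) (χ b * χ c * i a * (χ c * x b + x c - x (b * c)))

/-- The bracket is divisible by N, so the factors in front of it matter only modulo N; this is why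
`χ² ≡ 1` and the cocycle rule for `i` are needed only modulo N. Multiplicativity of `χ` is needed
modulo N², because its defect enters the cocycle identity for the bracket, which gets divided by N.
-/
theorem cup_isCocycle₃ {N : ℕ} (hN : N ≠ 0) {χ i x : G → ℤ}
    (hχ : ∀ a b, χ (a * b) ≡ χ a * χ b [ZMOD (N : ℤ) ^ 2])
    (hχ2 : ∀ a, χ a ^ 2 ≡ 1 [ZMOD N])
    (hi : ∀ a b, i (a * b) ≡ χ b * i a + i b [ZMOD N])
    (hx : ∀ a, x a ≡ i a [ZMOD N]) : IsCocycle₃ (cup N χ i x) := by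
  have hχ' : ∀ a b, ∃ k, χ (a * b) = χ a * χ b + N ^ 2 * k := fun a b => by
    obtain ⟨k, hk⟩ := (hχ a b).symm.dvd
    exact ⟨k, by linarith⟩
  have hχ2' : ∀ a, ∃ k, χ a ^ 2 = 1 + N * k := fun a => by
    obtain ⟨k, hk⟩ := (hχ2 a).symm.dvd
    exact ⟨k, by linarith⟩
  have hi' : ∀ a b, ∃ k, i (a * b) = χ b * i a + i b + N * k := fun a b => by
    obtain ⟨k, hk⟩ := (hi a b).symm.dvd
    exact ⟨k, by linarith⟩
  have hβ : ∀ a b, ∃ k, χ b * x a + x b - x (a * b) = N * k := fun a b => by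
    obtain ⟨k, hk⟩ := (((hx a).mul_left (χ b)).add (hx b)).trans
      ((hi a b).symm.trans (hx (a * b)).symm) |>.symm.dvd
    exact ⟨k, by linarith⟩
  intro a b c d
  simp only [cup, ← map_sub, ← map_add]
  rw [circ_eq_zero_iff (pow_ne_zero 2 hN)]
  obtain ⟨k1, h1⟩ := hχ' b c
  obtain ⟨k2, h2⟩ := hχ' c d
  obtain ⟨k3, h3⟩ := hχ2' d
  obtain ⟨k4, h4⟩ := hi' a b
  obtain ⟨b1, e1⟩ := hβ c d
  obtain ⟨b2, e2⟩ := hβ (b * c) d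
  obtain ⟨b3, e3⟩ := hβ b (c * d)
  obtain ⟨b4, e4⟩ := hβ b c
  have hN' : (N : ℤ) ≠ 0 := by exact_mod_cast hN
  -- the twisted cocycle identity for the Bockstein, divided by `N`
  have key : χ d * b4 + b2 - b3 - b1 = -(N * k2 * x b) := by
    apply mul_left_cancel₀ hN'
    have e3' := e3
    rw [h2] at e3'
    rw [← mul_assoc b c d] at e3'
    linear_combination -(χ d) * e4 - e2 + e3' + e1
  rw [e1, e2, e3, e4, h1, h2, h4]
  refine ⟨-(χ c * χ d * b1 * k4) + N * (k1 * χ d * i a * b2) - N * (χ b * k2 * i a * b3)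
    - i a * χ b * χ c * (k3 * b4 + k2 * x b * χ d), ?_⟩
  push_cast
  linear_combination N * i a * χ b * χ c * χ d * key - N * i a * χ b * χ c * b4 * h3

/-- The terms i(s)(x(s^m) - x(s^(m+1))) telescope away, leaving n copies of i(s) x(s). -/
theorem slant_cup {N : ℕ} {χ i x : G → ℤ} {s : G} {n : ℕ} (hs : s ^ n = 1)
    (hχ : ∀ m, χ (s ^ m) = 1) :
    slant s n (cup N χ i x) = circ (N ^ 2) (n * (i s * x s)) := by
  have h1 : χ s = 1 := by simpa using hχ 1
  have h : ∀ m ∈ Finset.range n, cup N χ i x s (s ^ m) s =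
      circ (N ^ 2) (i s * x s - (i s * x (s ^ (m + 1)) - i s * x (s ^ m))) := by
    intro m _
    rw [cup, hχ, h1, ← pow_succ]
    congr 1
    ring
  rw [slant, Finset.sum_congr rfl h, ← map_sum, Finset.sum_sub_distrib,
    Finset.sum_range_sub fun m => i s * x (s ^ m)]
  simp [hs]

end Cup

/-! ### Third cohomology of finite cyclic groups. -/

section Cyclic

variable {n : ℕ}

/-- The standard 3-cocycle on a finite cyclic group. -/
def cyclicCocycle (n : ℕ) :
    Multiplicative (ZMod n) → Multiplicative (ZMod n) → Multiplicative (ZMod n) →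
      Additive Circle :=
  cup n (fun _ => 1) (fun a => (Multiplicative.toAdd a).val) (fun a => (Multiplicative.toAdd a).val)

variable [NeZero n]

theorem cyclicCocycle_isCocycle₃ : IsCocycle₃ (cyclicCocycle n) := by
  refine cup_isCocycle₃ (NeZero.ne n) (fun _ _ => by simp) (fun _ => by simp)
    (fun a b => ?_) fun _ => rfl
  rw [← ZMod.intCast_eq_intCast_iff]
  simp

theorem slant_cyclicCocycle (j : ℤ) :
    slant (Multiplicative.ofAdd (j : ZMod n)) n (cyclicCocycle n) = circ n (j ^ 2) := by
  rw [cyclicCocycle, slant_cup (by rw [← ofAdd_nsmul]; simp) fun _ => rfl, sq n,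
    circ_mul_mul (NeZero.ne n), circ_eq_iff (NeZero.ne n), ← ZMod.intCast_zmod_eq_zero_iff_dvd]
  simp [sq]

/-- Up to isomorphisms this map is the projection from cycles to homology, which is an epimorphism.
-/
theorem groupCohomologyπOdd_surjective {k C : Type} [CommRing k] [CommGroup C] [Fintype C]
    (A : Rep k C) (g : C) (hg : ∀ x, x ∈ Subgroup.zpowers g) (i : ℕ) (hi : Odd i) :
    Function.Surjective (Rep.FiniteCyclicGroup.groupCohomologyπOdd A g hg i hi) := by
  intro y
  obtain ⟨z, hz⟩ := (ModuleCat.epi_iff_surjective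
    (Rep.FiniteCyclicGroup.subCompNormHom A g).homologyπ).1 inferInstance
      ((Rep.FiniteCyclicGroup.groupCohomologyIsoOdd A g hg i hi).hom y)
  refine ⟨(Rep.FiniteCyclicGroup.subCompNormHom A g).moduleCatCyclesIso.hom z, ?_⟩
  have h1 : (Rep.FiniteCyclicGroup.subCompNormHom A g).moduleCatCyclesIso.inv
      ((Rep.FiniteCyclicGroup.subCompNormHom A g).moduleCatCyclesIso.hom z) = z :=
    ConcreteCategory.congr_hom
      (Rep.FiniteCyclicGroup.subCompNormHom A g).moduleCatCyclesIso.hom_inv_id z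
  change (Rep.FiniteCyclicGroup.groupCohomologyIsoOdd A g hg i hi).inv
    ((Rep.FiniteCyclicGroup.subCompNormHom A g).homologyπ
      ((Rep.FiniteCyclicGroup.subCompNormHom A g).moduleCatCyclesIso.inv _)) = y
  rw [h1, hz]
  exact ConcreteCategory.congr_hom
    (Rep.FiniteCyclicGroup.groupCohomologyIsoOdd A g hg i hi).hom_inv_id y

/-- `H³` of a finite cyclic group of order `n` with trivial coefficients is a quotient of the
`n`-torsion of the coefficients. -/
theorem exists_surjective_torsion (n : ℕ) [NeZero n] (M : Type) [AddCommGroup M] :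
    ∃ F : {u : M // (n : ℤ) • u = 0} →
      groupCohomology (Rep.trivial ℤ (Multiplicative (ZMod n)) M) 3, Function.Surjective F := by
  have hg : ∀ x : Multiplicative (ZMod n),
      x ∈ Subgroup.zpowers (Multiplicative.ofAdd (1 : ZMod n)) := by
    intro x
    refine ⟨((Multiplicative.toAdd x).val : ℕ), ?_⟩
    beta_reduce
    rw [zpow_natCast, ← ofAdd_nsmul]
    simp
  -- With trivial coefficients the norm is multiplication by the group order, so its kernel is the
  -- n-torsion.
  have hnorm : ∀ u : M, (Rep.trivial ℤ (Multiplicative (ZMod n)) M).norm.hom.toLinearMap u =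
      (n : ℤ) • u := by
    intro u
    change (Representation.norm (Rep.trivial ℤ (Multiplicative (ZMod n)) M).ρ) u = _
    simp [Representation.norm]
  refine ⟨fun u => Rep.FiniteCyclicGroup.groupCohomologyπOdd _ _ hg 3 (by decide)
    ⟨u.1, (hnorm u.1).trans u.2⟩, fun y => ?_⟩
  obtain ⟨⟨u, hu⟩, rfl⟩ := groupCohomologyπOdd_surjective _ _ hg 3 (by decide) y
  exact ⟨⟨u, (hnorm u).symm.trans hu⟩, rfl⟩

theorem zsmul_circ_self (j : ℤ) : (n : ℤ) • circ n j = 0 := by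
  rw [← map_zsmul, circ_eq_zero_iff (NeZero.ne n)]
  exact ⟨j, by simp⟩

theorem surjective_circ_torsion :
    Function.Surjective fun k : ZMod n =>
      (⟨circ n k.val, zsmul_circ_self _⟩ : {u : Additive Circle // (n : ℤ) • u = 0}) := by
  rintro ⟨u, hu⟩
  obtain ⟨k, rfl⟩ := exists_circ_of_zsmul_eq_zero (NeZero.ne n) u hu
  refine ⟨k, Subtype.ext ?_⟩
  beta_reduce
  rw [circ_eq_iff (NeZero.ne n), ← ZMod.intCast_zmod_eq_zero_iff_dvd]
  simp

/-- `H³` of a finite cyclic group with values in the circle is generated by the standard class. -/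
theorem exists_sub_zsmul_cyclicCocycle
    {f : Multiplicative (ZMod n) → Multiplicative (ZMod n) → Multiplicative (ZMod n) →
      Additive Circle} (hf : IsCocycle₃ f) :
    ∃ k : ℤ, IsCoboundary₃ (f + (-1 : ℤ) • k • cyclicCocycle n) := by
  obtain ⟨F', hF'⟩ := exists_surjective_torsion n (Additive Circle)
  obtain ⟨F, hF⟩ : ∃ F : ZMod n → groupCohomology (Rep.trivial ℤ (Multiplicative (ZMod n))
      (Additive Circle)) 3, Function.Surjective F := ⟨_, hF'.comp surjective_circ_torsion⟩
  -- Counting: the slant at the generator separates these n multiples, and H³ has at most n elements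
  -- by `F`, so they exhaust it.
  let W : ZMod n → groupCohomology
      (Rep.trivial ℤ (Multiplicative (ZMod n)) (Additive Circle)) 3 := fun k =>
    class₃ ((k.val : ℤ) • cyclicCocycle n) (cyclicCocycle_isCocycle₃.zsmul _)
  have hW : Function.Injective W := by
    intro k l hkl
    have h := ((class₃_eq_iff _ _ _ _).1 hkl).slant_eq_zero
      (s := Multiplicative.ofAdd ((1 : ℤ) : ZMod n)) (n := n) (by rw [← ofAdd_nsmul]; simp)
    rw [slant_add, slant_zsmul, slant_zsmul, slant_zsmul, slant_cyclicCocycle, ← map_zsmul,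
      ← map_zsmul, ← map_zsmul, ← map_add, circ_eq_zero_iff (NeZero.ne n),
      ← ZMod.intCast_zmod_eq_zero_iff_dvd] at h
    simpa [← sub_eq_add_neg, sub_eq_zero] using h
  have : Finite (groupCohomology (Rep.trivial ℤ (Multiplicative (ZMod n))
      (Additive Circle)) 3) := Finite.of_surjective F hF
  have hWs := (hW.bijective_of_nat_card_le (Nat.card_le_card_of_surjective F hF)).2
  obtain ⟨k, hk⟩ := hWs (class₃ f hf)
  exact ⟨k.val, (class₃_eq_iff _ _ _ _).1 hk.symm⟩

end Cyclic

/-! ### Slant products as complete invariants of cyclic groups. -/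

section Cyclic

variable {n : ℕ} [NeZero n]

omit [NeZero n] in
theorem ofAdd_zmod_pow (x : Multiplicative (ZMod n)) : x ^ n = 1 := by
  rw [← ofAdd_toAdd x, ← ofAdd_nsmul]
  simp

theorem slant_eq_of_isCoboundary₃ {G M : Type} [Group G] [AddCommGroup M]
    {f g : G → G → G → M} (h : IsCoboundary₃ (f + (-1 : ℤ) • g)) {s : G} {n : ℕ} (hs : s ^ n = 1) :
    slant s n f = slant s n g := by
  have := h.slant_eq_zero hs
  rwa [slant_add, slant_zsmul, neg_one_zsmul, ← sub_eq_add_neg, sub_eq_zero] at this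

variable {f : Multiplicative (ZMod n) → Multiplicative (ZMod n) → Multiplicative (ZMod n) →
      Additive Circle}

theorem IsCocycle₃.exists_slant_eq (hf : IsCocycle₃ f) :
    ∃ k : ℤ, IsCoboundary₃ (f + (-1 : ℤ) • k • cyclicCocycle n) ∧
      ∀ j : ℤ, slant (Multiplicative.ofAdd (j : ZMod n)) n f = circ n (k * j ^ 2) := by
  obtain ⟨k, hk⟩ := exists_sub_zsmul_cyclicCocycle hf
  refine ⟨k, hk, fun j => ?_⟩
  rw [slant_eq_of_isCoboundary₃ hk (ofAdd_zmod_pow _), slant_zsmul, slant_cyclicCocycle,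
    ← map_zsmul, smul_eq_mul]

theorem IsCocycle₃.slant_ofAdd (hf : IsCocycle₃ f) (j : ℤ) :
    slant (Multiplicative.ofAdd (j : ZMod n)) n f =
      j ^ 2 • slant (Multiplicative.ofAdd (1 : ZMod n)) n f := by
  obtain ⟨k, -, hk⟩ := hf.exists_slant_eq
  have h1 := hk 1
  rw [Int.cast_one] at h1
  rw [hk, h1, ← map_zsmul]
  congr 1
  simp [mul_comm]

theorem IsCocycle₃.zsmul_slant (hf : IsCocycle₃ f) :
    (n : ℤ) • slant (Multiplicative.ofAdd (1 : ZMod n)) n f = 0 := by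
  obtain ⟨k, -, hk⟩ := hf.exists_slant_eq
  have h1 := hk 1
  rw [Int.cast_one] at h1
  rw [h1, zsmul_circ_self]

theorem IsCocycle₃.isCoboundary₃_of_slant_eq_zero (hf : IsCocycle₃ f)
    (h : slant (Multiplicative.ofAdd (1 : ZMod n)) n f = 0) : IsCoboundary₃ f := by
  obtain ⟨k, hc, hk⟩ := hf.exists_slant_eq
  have h1 := hk 1
  rw [Int.cast_one, h, eq_comm, circ_eq_zero_iff (NeZero.ne n)] at h1
  obtain ⟨l, hl⟩ := h1
  -- This multiple vanishes pointwise, since the carry in addition modulo n is a multiple of n.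
  have hn : IsCoboundary₃ ((n : ℤ) • cyclicCocycle n) := by
    have h0 : (n : ℤ) • cyclicCocycle n = 0 := by
      funext a b c
      simp only [Pi.smul_apply, Pi.zero_apply, cyclicCocycle, cup]
      rw [← map_zsmul, smul_eq_mul, sq n, circ_mul_mul (NeZero.ne n),
        circ_eq_zero_iff (NeZero.ne n), ← ZMod.intCast_zmod_eq_zero_iff_dvd]
      simp
    exact h0 ▸ ⟨0, by simp⟩
  have := hc.add (hn.zsmul l)
  rwa [smul_smul l, mul_comm l, ← hl, one_pow, mul_one, neg_one_zsmul, neg_add_cancel_right] at this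

end Cyclic

theorem zsmul_eq_zero_of_gcd {M : Type} [AddCommGroup M] {x : M} {a b : ℤ} (ha : a • x = 0)
    (hb : b • x = 0) : (Int.gcd a b : ℤ) • x = 0 := by
  rw [Int.gcd_eq_gcd_ab, add_smul, mul_comm a, mul_comm b, mul_smul, mul_smul, ha, hb, smul_zero,
    smul_zero, add_zero]

/-- A group generated by two elements which are independent of orders `m` and `n`. -/
theorem nonempty_addEquiv_zmod_prod {H : Type} [AddCommGroup H] (m n : ℕ) (u v : H)
    (hgen : ∀ x, ∃ k l : ℤ, k • u + l • v = x)
    (hker : ∀ k l : ℤ, k • u + l • v = 0 ↔ (m : ℤ) ∣ k ∧ (n : ℤ) ∣ l) :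
    Nonempty (H ≃+ ZMod m × ZMod n) := by
  let F : ZMod m × ZMod n →+ H := AddMonoidHom.coprod
    (ZMod.lift m ⟨zmultiplesHom H u, by simpa using (hker m 0).2 (by simp)⟩)
    (ZMod.lift n ⟨zmultiplesHom H v, by simpa using (hker 0 n).2 (by simp)⟩)
  have hF : ∀ k l : ℤ, F (k, l) = k • u + l • v := fun k l => by simp [F]
  refine ⟨(AddEquiv.ofBijective F ⟨(injective_iff_map_eq_zero F).2 ?_, fun x => ?_⟩).symm⟩
  · rintro ⟨a, b⟩ h
    obtain ⟨k, rfl⟩ := ZMod.intCast_surjective a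
    obtain ⟨l, rfl⟩ := ZMod.intCast_surjective b
    rw [hF, hker] at h
    exact Prod.ext ((ZMod.intCast_zmod_eq_zero_iff_dvd _ _).2 h.1)
      ((ZMod.intCast_zmod_eq_zero_iff_dvd _ _).2 h.2)
  · obtain ⟨k, l, h⟩ := hgen x
    exact ⟨(k, l), (hF k l).trans h⟩

/-! ### Arithmetic of φ, q and r. -/

section Arithmetic

variable {p q : ℕ} {φ : ℤ}

/-- Hensel lifting of a `p`-th root of unity modulo `q` to one modulo `q ^ 2`. -/
theorem exists_pow_modEq_one_sq [NeZero p] (hpq : Nat.Coprime p q) (hφ : φ ^ p ≡ 1 [ZMOD q]) :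
    ∃ ψ : ℤ, ψ ≡ φ [ZMOD q] ∧ ψ ^ p ≡ 1 [ZMOD (q : ℤ) ^ 2] := by
  obtain ⟨s, hs⟩ := hφ.symm.dvd
  obtain ⟨m, rfl⟩ := Nat.exists_eq_succ_of_ne_zero (NeZero.ne p)
  obtain ⟨a, b, hab⟩ := Int.isCoprime_iff_gcd_eq_one.2
    (show Int.gcd (m + 1 : ℕ) q = 1 from hpq)
  -- One Newton step: with φ^p = 1 + q s, the correction changes φ^p by the factor 1 - p a q s
  -- modulo q², and p a ≡ 1 modulo q.
  refine ⟨φ + q * (-(s * a * φ)), ?_, ?_⟩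
  · exact (Int.modEq_iff_dvd.2 ⟨s * a * φ, by ring⟩)
  · obtain ⟨k, hk⟩ := Polynomial.powAddExpansion φ (q * (-(s * a * φ))) (m + 1)
    refine (Int.modEq_iff_dvd.2 ⟨s * b - (m + 1) * s ^ 2 * a + k * (s * a * φ) ^ 2, ?_⟩).symm
    rw [Nat.succ_eq_add_one] at hs ⊢
    rw [hk]
    push_cast at hab ⊢
    linear_combination (1 - (m + 1) * q * s * a) * hs - q * s * hab

/-- The greatest common divisor `r` of `φ ^ 2 - 1` and `q` is a unitary divisor of `q`. -/
theorem exists_eq_gcd_mul [NeZero q] (hpq : Nat.Coprime p q) (hφ : φ ^ p ≡ 1 [ZMOD q]) :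
    ∃ t : ℤ, (q : ℤ) = Int.gcd (φ ^ 2 - 1) q * t ∧ IsCoprime t (Int.gcd (φ ^ 2 - 1) q : ℤ) := by
  set r := Int.gcd (φ ^ 2 - 1) q with hr
  have hr0 : (r : ℤ) ≠ 0 := by
    rw [hr]
    exact_mod_cast (Int.gcd_pos_of_ne_zero_right _ (by exact_mod_cast NeZero.ne q)).ne'
  obtain ⟨t, ht⟩ : (r : ℤ) ∣ q := Int.gcd_dvd_right _ _
  obtain ⟨w, hw⟩ : (r : ℤ) ∣ φ ^ 2 - 1 := Int.gcd_dvd_left _ _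
  refine ⟨t, ht, ?_⟩
  -- the norm element `N` is divisible by `q / r` and congruent to `p` modulo `r`
  set N := ∑ i ∈ Finset.range p, (φ ^ 2) ^ i with hN
  have htw : IsCoprime t w := by
    obtain ⟨a, b, h⟩ : ∃ a b : ℤ, (r : ℤ) = (φ ^ 2 - 1) * a + q * b :=
      ⟨_, _, Int.gcd_eq_gcd_ab _ _⟩
    refine ⟨b, a, mul_left_cancel₀ hr0 ?_⟩
    rw [hw] at h
    linear_combination -h - b * ht
  -- `q` divides N(φ² - 1) = φ^(2p) - 1; cancelling r leaves t ∣ N w, and t is prime to w.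
  have htN : t ∣ N := by
    have h1 : (q : ℤ) ∣ N * (φ ^ 2 - 1) := by
      rw [hN, geom_sum_mul, ← pow_mul, mul_comm, pow_mul]
      exact ((hφ.pow 2).trans (by simp)).symm.dvd
    rw [ht, hw, mul_left_comm] at h1
    exact htw.dvd_of_dvd_mul_right ((mul_dvd_mul_iff_left hr0).1 h1)
  have hNr : N ≡ p [ZMOD r] := by
    have h1 : φ ^ 2 ≡ 1 [ZMOD r] := (Int.modEq_iff_dvd.2 ⟨w, hw⟩).symm
    rw [← ZMod.intCast_eq_intCast_iff] at h1 ⊢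
    rw [hN, Int.cast_sum]
    simp_rw [Int.cast_pow (φ ^ 2), h1]
    simp
  have hpr : IsCoprime (p : ℤ) r :=
    (Int.isCoprime_iff_gcd_eq_one.2 (show Int.gcd p q = 1 from hpq)).of_isCoprime_of_dvd_right
      ⟨t, ht⟩
  obtain ⟨k, hk⟩ := hNr.symm.dvd
  have hNr' : IsCoprime N r := by
    rw [show N = p + r * k by linarith]
    exact hpr.add_mul_left_left k
  exact hNr'.of_isCoprime_of_dvd_left htN

end Arithmetic

/-! ### Coordinates on the group and slant products of the two explicit cocycles. -/

section Group

variable {p q : ℕ} [NeZero p] {φ : ℤ} {hφ : φ ^ p ≡ 1 [ZMOD q]}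

theorem toAdd_action (g : Multiplicative (ZMod p)) (x : Multiplicative (ZMod q)) :
    Multiplicative.toAdd (action p q φ hφ g x) =
      (φ : ZMod q) ^ (Multiplicative.toAdd g).val * Multiplicative.toAdd x := rfl

theorem bigExp_mul (g h : Grp p q φ hφ) : bigExp (g * h) = (bigExp g + bigExp h) % p :=
  ZMod.val_add _ _

/-- The semidirect product stores elements as a^x A^I, while `smallExp` refers to A^I a^i; moving
A^I across multiplies the exponent by φ^I. -/
theorem toAdd_left [NeZero q] (g : Grp p q φ hφ) :
    Multiplicative.toAdd g.left = (φ : ZMod q) ^ bigExp g * smallExp g := by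
  have h : g.left = action p q φ hφ g.right ((SemidirectProduct.inr g.right)⁻¹ * g).left := by
    rw [← map_inv, SemidirectProduct.mul_left]
    simp
  rw [h, toAdd_action, smallExp, ZMod.natCast_zmod_val]
  rfl

/-- From A^I a^i A^J a^j = A^(I+J) a^(φ^(-J) i + j), multiplied by φ^J to avoid the inverse. -/
theorem smallExp_mul [NeZero q] (g h : Grp p q φ hφ) :
    (φ : ZMod q) ^ bigExp h * smallExp (g * h) =
      (smallExp g : ZMod q) + (φ : ZMod q) ^ bigExp h * smallExp h := by
  have h1 := toAdd_left (g * h)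
  rw [SemidirectProduct.mul_left, toAdd_mul, toAdd_action, toAdd_left g, toAdd_left h, bigExp_mul,
    pow_mod_eq hφ, pow_add] at h1
  have hu : IsUnit ((φ : ZMod q) ^ bigExp g) := IsUnit.of_mul_eq_one_right _
    (pow_mul_pow_eq_one hφ (bigExp g))
  refine hu.mul_left_cancel ?_
  rw [← mul_assoc, ← h1, mul_add]
  rfl

/-- The exponent of `a` is a twisted 1-cocycle modulo any divisor `r` of `q` with
`φ ^ 2 ≡ 1 (mod r)`. -/
theorem smallExp_mul_modEq [NeZero q] {r : ℕ} (hrq : r ∣ q) {ψ : ℤ} (hψ : ψ ≡ φ [ZMOD q])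
    (hψ2 : ψ ^ 2 ≡ 1 [ZMOD r]) (g h : Grp p q φ hφ) :
    (smallExp (g * h) : ℤ) ≡ ψ ^ bigExp h * smallExp g + smallExp h [ZMOD r] := by
  have h1 : (φ ^ bigExp h * smallExp (g * h) : ℤ) ≡
      smallExp g + φ ^ bigExp h * smallExp h [ZMOD q] := by
    rw [← ZMod.intCast_eq_intCast_iff]
    push_cast
    exact smallExp_mul g h
  have hp : ψ ^ bigExp h ≡ φ ^ bigExp h [ZMOD q] := hψ.pow _
  have h2 := ((hp.mul_right _).trans (h1.trans ((hp.mul_right _).symm.add_left _))).of_dvd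
    (Int.natCast_dvd_natCast.2 hrq)
  -- Modulo r the twist is its own inverse, so φ^(-J) may be replaced by ψ^J.
  have h3 : ψ ^ bigExp h * ψ ^ bigExp h ≡ 1 [ZMOD r] := by
    rw [← pow_add, ← two_mul, pow_mul]
    simpa using hψ2.pow (bigExp h)
  have h4 := h2.mul_left (ψ ^ bigExp h)
  rw [mul_add, ← mul_assoc, ← mul_assoc] at h4
  simpa using ((h3.mul_right _).symm.trans h4).trans ((h3.mul_right _).add_left _)

theorem curry₃_omegaP : curry₃ (omegaP p q φ hφ) =
    cup p (fun _ => 1) (fun g => bigExp g) fun g => bigExp g := by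
  funext a b c
  have : (bigExp (b * c) : ℤ) = ((bigExp b : ℤ) + bigExp c) % p := by
    rw [bigExp_mul]
    push_cast
    rfl
  simp only [curry₃, omegaP, cup, this, circ]
  simp

theorem curry₃_omegaR [NeZero q] {r : ℕ} (hrq : r ∣ q) {ψ : ℤ} (hψ : ψ ≡ φ [ZMOD q])
    (hψ2 : ψ ^ 2 ≡ 1 [ZMOD r]) : curry₃ (omegaR p q φ hφ r ψ) =
      cup r (fun g => ψ ^ bigExp g) (fun g => smallExp g) fun g => smallExp g % r := by
  funext a b c
  have : (smallExp (b * c) : ℤ) % r = (ψ ^ bigExp c * smallExp b + smallExp c) % r :=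
    smallExp_mul_modEq hrq hψ hψ2 b c
  simp only [curry₃, omegaR, cup, this, circ]
  simp [pow_add]

theorem isCocycle₃_omegaP : IsCocycle₃ (curry₃ (omegaP p q φ hφ)) := by
  rw [curry₃_omegaP]
  refine cup_isCocycle₃ (NeZero.ne p) (fun _ _ => by simp) (fun _ => by simp)
    (fun a b => ?_) fun _ => rfl
  rw [bigExp_mul, one_mul]
  push_cast
  exact Int.mod_modEq _ _

theorem isCocycle₃_omegaR [NeZero q] {r : ℕ} (hrq : r ∣ q) {ψ : ℤ} (hψ : ψ ≡ φ [ZMOD q])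
    (hψ2 : ψ ^ 2 ≡ 1 [ZMOD r]) (hψp : ψ ^ p ≡ 1 [ZMOD (r : ℤ) ^ 2]) :
    IsCocycle₃ (curry₃ (omegaR p q φ hφ r ψ)) := by
  rw [curry₃_omegaR hrq hψ hψ2]
  refine cup_isCocycle₃ (fun h => NeZero.ne q (by simpa [h] using hrq)) (fun a b => ?_)
    (fun a => ?_) (smallExp_mul_modEq hrq hψ hψ2) fun _ => Int.mod_modEq _ _
  -- The exponent of `A` is reduced modulo p; the dropped multiple of p is harmless because `ψ ^ p ≡
  -- 1` modulo r².
  · rw [← pow_add, bigExp_mul]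
    conv_rhs => rw [← Nat.mod_add_div (bigExp a + bigExp b) p, pow_add, pow_mul]
    simpa using (((hψp.pow _).mul_left _).symm :
      _ * 1 ^ ((bigExp a + bigExp b) / p) ≡ _ [ZMOD (r : ℤ) ^ 2])
  · rw [← pow_mul, mul_comm, pow_mul]
    simpa using hψ2.pow (bigExp a)

theorem genBigA_pow_bigExp (m : ℕ) : bigExp (genBigA p q φ hφ ^ m) = m % p := by
  rw [genBigA, ← map_pow, ← ofAdd_nsmul]
  simp [bigExp, ZMod.val_natCast]

theorem genBigA_pow_smallExp (m : ℕ) : smallExp (genBigA p q φ hφ ^ m) = 0 := by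
  rw [genBigA, ← map_pow, ← ofAdd_nsmul]
  simp [smallExp]

theorem genSmallA_pow_bigExp (m : ℕ) : bigExp (genSmallA p q φ hφ ^ m) = 0 := by
  rw [genSmallA, ← map_pow, ← ofAdd_nsmul]
  simp [bigExp]

theorem genSmallA_pow_smallExp (m : ℕ) : smallExp (genSmallA p q φ hφ ^ m) = m % q := by
  rw [genSmallA, ← map_pow, ← ofAdd_nsmul]
  simp [smallExp, ZMod.val_natCast]

theorem slant_genBigA_omegaP :
    slant (genBigA p q φ hφ) p (curry₃ (omegaP p q φ hφ)) = circ p 1 := by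
  have h := genBigA_pow_bigExp (hφ := hφ) 1
  rw [pow_one] at h
  rw [curry₃_omegaP, slant_cup genBigA_pow fun _ => rfl, h, sq p, circ_mul_mul (NeZero.ne p),
    circ_eq_iff (NeZero.ne p), ← ZMod.intCast_zmod_eq_zero_iff_dvd]
  simp

theorem slant_genSmallA_omegaP :
    slant (genSmallA p q φ hφ) q (curry₃ (omegaP p q φ hφ)) = 0 := by
  have h := genSmallA_pow_bigExp (hφ := hφ) 1
  rw [pow_one] at h
  rw [curry₃_omegaP, slant_cup genSmallA_pow fun _ => rfl, h]
  simp

theorem slant_genBigA_omegaR [NeZero q] {r : ℕ} (hrq : r ∣ q) {ψ : ℤ} (hψ : ψ ≡ φ [ZMOD q])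
    (hψ2 : ψ ^ 2 ≡ 1 [ZMOD r]) :
    slant (genBigA p q φ hφ) p (curry₃ (omegaR p q φ hφ r ψ)) = 0 := by
  have h := genBigA_pow_smallExp (hφ := hφ) 1
  rw [pow_one] at h
  rw [curry₃_omegaR hrq hψ hψ2]
  simp [slant, cup, h]

/-- By `slant_cup` the angle is q/r² = t/r of a full turn. -/
theorem slant_genSmallA_omegaR [NeZero q] {r : ℕ} (hrq : r ∣ q) {ψ : ℤ} (hψ : ψ ≡ φ [ZMOD q])
    (hψ2 : ψ ^ 2 ≡ 1 [ZMOD r]) {t : ℤ} (ht : (q : ℤ) = r * t) :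
    slant (genSmallA p q φ hφ) q (curry₃ (omegaR p q φ hφ r ψ)) = circ r t := by
  have hr : r ≠ 0 := fun h => NeZero.ne q (by simpa [h] using hrq)
  have h := genSmallA_pow_smallExp (hφ := hφ) 1
  rw [pow_one] at h
  rw [curry₃_omegaR hrq hψ hψ2, slant_cup genSmallA_pow
    fun m => by simp [genSmallA_pow_bigExp], h, ht, sq r, mul_assoc, circ_mul_mul hr,
    circ_eq_iff hr, ← ZMod.intCast_zmod_eq_zero_iff_dvd]
  -- The remainder covers q = 1, where the exponent of `a` is 0 but r = 1 as well.
  have h1 : ((1 % q : ℕ) : ZMod r) = 1 := by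
    have := (ZMod.natCast_eq_natCast_iff _ _ _).2 ((Nat.mod_modEq 1 q).of_dvd hrq)
    rwa [Nat.cast_one] at this
  rw [Int.cast_sub, Int.cast_mul, Int.cast_mul, ZMod.intCast_mod, Int.cast_natCast, h1]
  simp

/-! ### Detection of classes by the two slant products. -/

section Detection

variable [NeZero q] {f : Grp p q φ hφ → Grp p q φ hφ → Grp p q φ hφ → Additive Circle}

omit [NeZero q] in
theorem IsCocycle₃.zsmul_slant_genBigA (hf : IsCocycle₃ f) :
    (p : ℤ) • slant (genBigA p q φ hφ) p f = 0 := by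
  have := (hf.comp (SemidirectProduct.inr (φ := action p q φ hφ))).zsmul_slant
  simpa only [slant, map_pow, genBigA] using this

/-- Conjugation by `A` preserves the slant product and replaces `a` by `a ^ φ`, which multiplies it
by φ². So φ² - 1 kills it, as does q. -/
theorem IsCocycle₃.zsmul_slant_genSmallA (hf : IsCocycle₃ f) :
    (Int.gcd (φ ^ 2 - 1) q : ℤ) • slant (genSmallA p q φ hφ) q f = 0 := by
  have hc := hf.comp (SemidirectProduct.inl (φ := action p q φ hφ))
  refine zsmul_eq_zero_of_gcd ?_ ?_
  · have h1 := hc.slant_ofAdd φ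
    have h2 := (hf.conj_sub (genBigA p q φ hφ)).slant_eq_zero genSmallA_pow
    simp only [slant, Finset.sum_sub_distrib, ← conj_pow] at h2
    have h3 : genBigA p q φ hφ * genSmallA p q φ hφ * (genBigA p q φ hφ)⁻¹ =
        SemidirectProduct.inl (Multiplicative.ofAdd (φ : ZMod q)) := by
      rw [genBigA_conj, genSmallA, ← map_zpow, ← ofAdd_zsmul]
      simp
    rw [sub_smul, one_smul]
    simp only [h3] at h2
    simp only [slant, map_pow] at h1
    rw [h1] at h2
    exact h2
  · simpa only [slant, map_pow, genSmallA] using hc.zsmul_slant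

/-- The slant products with the two generators detect the classes of 3-cocycles. -/
theorem IsCocycle₃.isCoboundary₃_of_slant (hpq : Nat.Coprime p q) (hf : IsCocycle₃ f)
    (hA : slant (genBigA p q φ hφ) p f = 0) (ha : slant (genSmallA p q φ hφ) q f = 0) :
    IsCoboundary₃ f := by
  have h1 : IsCoboundary₃ ((q : ℤ) • f) := by
    have := hf.transfer (SemidirectProduct.inr (φ := action p q φ hφ)) (fun g => g.right)
      (fun c x => by simp) (T := Multiplicative (ZMod q)) SemidirectProduct.inl
      -- For g = a^l A^R, moving A^R to the left of a^t g turns the representative a^t into the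
      -- image of a^(t+l) under the action of A^(-R).
      (fun g => ⟨(Equiv.mulRight g.left).trans (action p q φ hφ g.right⁻¹).toEquiv,
        fun t => ⟨g.right, by ext <;> simp⟩⟩)
      ((hf.comp _).isCoboundary₃_of_slant_eq_zero
        (by simpa only [slant, map_pow, genBigA] using hA))
    simpa using this
  have h2 : IsCoboundary₃ ((p : ℤ) • f) := by
    have := hf.transfer (SemidirectProduct.inl (φ := action p q φ hφ)) (fun g => g.left)
      (fun c x => by simp) (T := Multiplicative (ZMod p)) SemidirectProduct.inr
      (fun g => ⟨Equiv.mulRight g.right, fun t => ⟨action p q φ hφ t g.left, by ext <;> simp⟩⟩)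
      ((hf.comp _).isCoboundary₃_of_slant_eq_zero
        (by simpa only [slant, map_pow, genSmallA] using ha))
    simpa using this
  -- The two transfers kill the class by q and by p, which are coprime.
  obtain ⟨a, b, hab⟩ := Int.isCoprime_iff_gcd_eq_one.2 (show Int.gcd p q = 1 from hpq)
  have := (h2.zsmul a).add (h1.zsmul b)
  rwa [smul_smul, smul_smul, ← add_smul, hab, one_smul] at this

end Detection

end Group

end QP

end

/-! ### The main theorem. -/

open QP in
theorem mainTheorem7 (p q : ℕ) [NeZero p] [NeZero q] (hpq : Nat.Coprime p q)
    (φ : ℤ) (hφ : φ ^ p ≡ 1 [ZMOD q]) (r : ℕ) (hr : r = Int.gcd (φ ^ 2 - 1) q) :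
    Nonempty (QP.H3 p q φ hφ ≃+ ZMod p × ZMod r) ∧
    (∃ ψ : ℤ, ψ ≡ φ [ZMOD q] ∧ ψ ^ p ≡ 1 [ZMOD (r : ℤ) ^ 2]) ∧
    ∀ ψ : ℤ, ψ ≡ φ [ZMOD q] → ψ ^ p ≡ 1 [ZMOD (r : ℤ) ^ 2] →
      ∃ (hcp : QP.IsCocycle p q φ hφ (QP.omegaP p q φ hφ))
        (hcr : QP.IsCocycle p q φ hφ (QP.omegaR p q φ hφ r ψ)),
        AddSubgroup.closure
          {QP.cls p q φ hφ (QP.omegaP p q φ hφ) hcp,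
            QP.cls p q φ hφ (QP.omegaR p q φ hφ r ψ) hcr} = ⊤ := by
  obtain ⟨t, ht, htr⟩ := exists_eq_gcd_mul hpq hφ
  rw [← hr] at ht htr
  have hrq : r ∣ q := Int.natCast_dvd_natCast.1 ⟨t, ht⟩
  have hr0 : r ≠ 0 := fun h => NeZero.ne q (by simpa [h] using hrq)
  have hφ2 : φ ^ 2 ≡ 1 [ZMOD r] :=
    (Int.modEq_iff_dvd.2 (hr ▸ Int.gcd_dvd_left _ _)).symm
  have key : ∀ ψ : ℤ, ψ ≡ φ [ZMOD q] → ψ ^ p ≡ 1 [ZMOD (r : ℤ) ^ 2] →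
      ∃ (hp : IsCocycle₃ (curry₃ (omegaP p q φ hφ)))
        (hr : IsCocycle₃ (curry₃ (omegaR p q φ hφ r ψ))),
        (∀ x : H3 p q φ hφ, ∃ k l : ℤ, k • class₃ _ hp + l • class₃ _ hr = x) ∧
        ∀ k l : ℤ, k • class₃ _ hp + l • class₃ _ hr = 0 ↔ (p : ℤ) ∣ k ∧ (r : ℤ) ∣ l := by
    intro ψ hψ hψp
    have hψ2 : ψ ^ 2 ≡ 1 [ZMOD r] :=
      ((hψ.of_dvd (Int.natCast_dvd_natCast.2 hrq)).pow 2).trans hφ2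
    have hP := isCocycle₃_omegaP (hφ := hφ)
    have hR := isCocycle₃_omegaR (hφ := hφ) hrq hψ hψ2 hψp
    have hB : ∀ k l : ℤ, slant (genBigA p q φ hφ) p
        (k • curry₃ (omegaP p q φ hφ) + l • curry₃ (omegaR p q φ hφ r ψ)) = circ p k := by
      intro k l
      rw [slant_add, slant_zsmul, slant_zsmul, slant_genBigA_omegaP,
        slant_genBigA_omegaR hrq hψ hψ2, smul_zero, add_zero, ← map_zsmul, smul_eq_mul, mul_one]
    have hS : ∀ k l : ℤ, slant (genSmallA p q φ hφ) q
        (k • curry₃ (omegaP p q φ hφ) + l • curry₃ (omegaR p q φ hφ r ψ)) = circ r (l * t) := by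
      intro k l
      rw [slant_add, slant_zsmul, slant_zsmul, slant_genSmallA_omegaP,
        slant_genSmallA_omegaR hrq hψ hψ2 ht, smul_zero, zero_add, ← map_zsmul, smul_eq_mul]
    refine ⟨hP, hR, fun x => ?_, fun k l => ?_⟩
    · obtain ⟨f, hf, rfl⟩ := exists_class₃ x
      obtain ⟨k, hk⟩ := exists_circ_of_zsmul_eq_zero (NeZero.ne p) _ hf.zsmul_slant_genBigA
      obtain ⟨l, hl⟩ := exists_circ_of_zsmul_eq_zero hr0 _ (hr ▸ hf.zsmul_slant_genSmallA)
      obtain ⟨a, b, hab⟩ := htr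
      -- `omegaR` has slant t/r rather than 1/r at `a`, so l is multiplied by the inverse `a` of t
      -- modulo r.
      refine ⟨k, l * a, ?_⟩
      have hlin := (hP.zsmul k).add (hR.zsmul (l * a))
      rw [← class₃_zsmul, ← class₃_zsmul, ← class₃_add, class₃_eq_iff]
      refine (hlin.add (hf.zsmul (-1))).isCoboundary₃_of_slant hpq ?_ ?_
      · rw [slant_add, hB, slant_zsmul, hk, neg_one_zsmul, add_neg_cancel]
      · rw [slant_add, hS, slant_zsmul, hl, ← map_zsmul, ← map_add, circ_eq_zero_iff hr0]
        exact ⟨-(l * b), by rw [smul_eq_mul]; linear_combination l * hab⟩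
    · rw [← class₃_zsmul, ← class₃_zsmul, ← class₃_add, class₃_eq_zero_iff]
      have hlin := (hP.zsmul k).add (hR.zsmul l)
      have hiff : (r : ℤ) ∣ l ↔ circ r (l * t) = 0 := by
        rw [circ_eq_zero_iff hr0]
        exact ⟨fun h => h.mul_right t, fun h => htr.symm.dvd_of_dvd_mul_right h⟩
      rw [hiff, ← circ_eq_zero_iff (NeZero.ne p), ← hB k l, ← hS k l]
      exact ⟨fun h => ⟨h.slant_eq_zero genBigA_pow, h.slant_eq_zero genSmallA_pow⟩,
        fun h => hlin.isCoboundary₃_of_slant hpq h.1 h.2⟩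
  have hex : ∃ ψ : ℤ, ψ ≡ φ [ZMOD q] ∧ ψ ^ p ≡ 1 [ZMOD (r : ℤ) ^ 2] := by
    obtain ⟨ψ, h1, h2⟩ := exists_pow_modEq_one_sq hpq hφ
    -- The lift modulo q² suffices because r divides q.
    exact ⟨ψ, h1, h2.of_dvd (pow_dvd_pow_of_dvd (Int.natCast_dvd_natCast.2 hrq) 2)⟩
  refine ⟨?_, hex, fun ψ hψ hψp => ?_⟩
  · obtain ⟨ψ, hψ, hψp⟩ := hex
    obtain ⟨hP, hR, hgen, hker⟩ := key ψ hψ hψp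
    exact nonempty_addEquiv_zmod_prod p r _ _ hgen hker
  · obtain ⟨hP, hR, hgen, -⟩ := key ψ hψ hψp
    have hcp : IsCocycle p q φ hφ (omegaP p q φ hφ) := (d_three_eq_zero_iff _).2 hP
    have hcr : IsCocycle p q φ hφ (omegaR p q φ hφ r ψ) := (d_three_eq_zero_iff _).2 hR
    have hp : cls p q φ hφ _ hcp = class₃ _ hP := π_cocyclesMk_eq_class₃ _ _
    have hr' : cls p q φ hφ _ hcr = class₃ _ hR := π_cocyclesMk_eq_class₃ _ _
    refine ⟨hcp, hcr, ?_⟩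
    rw [hp, hr', eq_top_iff]
    exact fun x _ => AddSubgroup.mem_closure_pair.2 (hgen x)
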